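/- Let $a,b,c\in\mathbb R$ with $c>0$, and consider the singular initial value problem $$x^2u''=axu'+bu-c(u'-1)^2,\qquad u(0)=0.$$ For $0<x_0<\infty$, a solution on $[0,x_0]$ is a function $u\in C^0([0,x_0])\cap C^2((0,x_0))$ that satisfies the equation for all $x\in(0,x_0)$ and $u(0)=0$; a solution on $[0,\infty)$ is a function $u\in C^0([0,\infty))\cap C^2((0,\infty))$ that satisfies the equation for all $x>0$ and $u(0)=0$. (i) If $a+b>0$, then for every $x_0\in(0,\infty)$ there is a continuum of solutions on $[0,x_0]$ with $0\le u(x)\le x$ for all $x\in[0,x_0]$; that is, the set of these solutions has the cardinality of the continuum. (ii) If $a+b\ge 0$, then there is at least one solution on $[0,\infty)$ with $0\le u(x)\le x$ for all $x\ge 0$. -/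

import Mathlib

/-- `u` is a solution on the interval `I` (of the form `[0, x₀]` or `[0, ∞)`) of the singular
initial value problem `x² u'' = a x u' + b u - c (u' - 1)²`, `u(0) = 0`:
it is continuous on `I`, of class `C²` in the interior of `I`, satisfies the equation there,
and vanishes at `0`. Only the values of `u` on `I` matter: the interior is open, so the
derivatives at its points do not depend on `u` outside `I`. -/
structure IsSingularIVPSolution (a b c : ℝ) (I : Set ℝ) (u : ℝ → ℝ) : Prop where
  continuousOn : ContinuousOn u I
  contDiffOn : ContDiffOn ℝ 2 u (interior I)
  equation : ∀ x ∈ interior I,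
    x ^ 2 * deriv (deriv u) x = a * x * deriv u x + b * u x - c * (deriv u x - 1) ^ 2
  initial : u 0 = 0

/-- The set of all solutions on `[0, x₀]` with `0 ≤ u(x) ≤ x`, as functions defined on `[0, x₀]`
(so that two solutions are different only if they differ somewhere on `[0, x₀]`). -/
def boundedSolutions (a b c x₀ : ℝ) : Set (Set.Icc (0 : ℝ) x₀ → ℝ) :=
  {v | ∃ u : ℝ → ℝ, IsSingularIVPSolution a b c (Set.Icc 0 x₀) u ∧
    (∀ x ∈ Set.Icc (0 : ℝ) x₀, 0 ≤ u x ∧ u x ≤ x) ∧ (Set.Icc (0 : ℝ) x₀).domRestrict u = v}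

open Set Filter Metric
open scoped Topology NNReal

/-! ### Global flow and uniqueness for bounded Lipschitz fields. -/

section ODE

variable {E : Type*} [NormedAddCommGroup E] [NormedSpace ℝ E]

/-! The functions `0` and `x` are a lower and an upper solution: inserting them into the right-hand
side solved for `u''` gives `-c / x ^ 2 ≤ 0` and `(a + b) / x ≥ 0`. On an interval `[s, t]` with `s
> 0` the equation is regular, so for each `ξ ∈ [0, t]` the boundary problem `u s = 0`, `u t = ξ` is
solvable in the strip `0 ≤ u ≤ x` (`exists_strip_solution_Icc`). The equation is first truncated to
a bounded Lipschitz system, which is solved by shooting from `t`. A maximum principle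
(`IsIntegralCurveOn.inStrip`) confines the solution to the strip. Growth of `u''` at most quadratic
in `u'` yields a slope bound independent of the truncation level (`exists_slope_bound`), so the
truncation is inactive.

To reach the singular point, let `s` decrease to `0`. The data at a fixed point `e` of strip
solutions on `[s, t]` form nested nonempty compact sets (`isCompact_stripData`); a common point
launches one solution on the whole union (`exists_solution_of_exhaustion`). Continuity at `0` is
forced by `0 ≤ u ≤ x`.

With `e = x₀` the terminal value `ξ ∈ [0, x₀]` can be prescribed, which gives continuum many
solutions; there are no more, since they are continuous on a separable space. Letting `t` grow as
well gives the solution on `[0, ∞)`. -/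

theorem exists_flow_of_bounded_of_lipschitz [CompleteSpace E] {v : ℝ → E → E} {s t e : ℝ}
    (he : e ∈ Icc s t) {K : ℝ≥0} {L : ℝ} (hK : ∀ x ∈ Icc s t, LipschitzWith K (v x))
    (hc : ∀ z, ContinuousOn (v · z) (Icc s t)) (hL : ∀ x ∈ Icc s t, ∀ z, ‖v x z‖ ≤ L) (R : ℝ) :
    ∃ Φ : E → ℝ → E, (∀ z ∈ closedBall (0 : E) R, Φ z e = z ∧ IsIntegralCurveOn (Φ z) v (Icc s t)) ∧
      ∀ x ∈ Icc s t, ContinuousOn (Φ · x) (closedBall 0 R) := by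
  have hL0 : 0 ≤ L := (norm_nonneg _).trans (hL e he 0)
  have hst : 0 ≤ t - s := sub_nonneg.2 (he.1.trans he.2)
  -- Speed at most `L` for time at most `t - s` moves a point by at most `L * (t - s)`, so this
  -- radius leaves room for every starting point in the `R`-ball and the flow lives on all of `[s,
  -- t]`.
  have h : IsPicardLindelof v (⟨e, he⟩ : Icc s t) 0
      (⟨L, hL0⟩ * ⟨t - s, hst⟩ + R.toNNReal) R.toNNReal ⟨L, hL0⟩ K :=
    { lipschitzOnWith := fun x hx ↦ (hK x hx).lipschitzOnWith
      continuousOn := fun z _ ↦ hc z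
      norm_le := fun x hx z _ ↦ hL x hx z
      mul_max_le := by
        push_cast
        rw [add_sub_cancel_right]
        exact mul_le_mul_of_nonneg_left
          (max_le (by linarith [he.1]) (by linarith [he.2])) hL0 }
  obtain ⟨Φ, h1, L', h2⟩ := h.exists_forall_mem_closedBall_eq_hasDerivWithinAt_lipschitzOnWith
  have hR : closedBall (0 : E) R ⊆ closedBall 0 (R.toNNReal : ℝ) :=
    closedBall_subset_closedBall (Real.le_coe_toNNReal R)
  exact ⟨Φ, fun z hz ↦ h1 z (hR hz), fun x hx ↦ (h2 x hx).continuousOn.mono hR⟩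

theorem IsIntegralCurveOn.eqOn_Icc_of_lipschitz {v : ℝ → E → E} {s t e : ℝ}
    (he : e ∈ Icc s t) {K : ℝ≥0} (hK : ∀ x ∈ Icc s t, LipschitzWith K (v x)) {y z : ℝ → E}
    (hy : IsIntegralCurveOn y v (Icc s t)) (hz : IsIntegralCurveOn z v (Icc s t))
    (h : y e = z e) : EqOn y z (Icc s t) := by
  have hl : Icc s e ⊆ Icc s t := Icc_subset_Icc_right he.2
  have hr : Icc e t ⊆ Icc s t := Icc_subset_Icc_left he.1
  have left : ∀ {w : ℝ → E}, IsIntegralCurveOn w v (Icc s t) →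
      ∀ x ∈ Ioc s e, HasDerivWithinAt w (v x (w x)) (Iic x) x := fun {w} hw x hx ↦
    (hw x (hl (Ioc_subset_Icc_self hx))).mono_of_mem_nhdsWithin
      (mem_of_superset (Ioc_mem_nhdsLE hx.1)
        (Ioc_subset_Icc_self.trans (Icc_subset_Icc_right (hx.2.trans he.2))))
  have right : ∀ {w : ℝ → E}, IsIntegralCurveOn w v (Icc s t) →
      ∀ x ∈ Ico e t, HasDerivWithinAt w (v x (w x)) (Ici x) x := fun {w} hw x hx ↦
    (hw x (hr (Ico_subset_Icc_self hx))).mono_of_mem_nhdsWithin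
      (mem_of_superset (Ico_mem_nhdsGE hx.2)
        (Ico_subset_Icc_self.trans (Icc_subset_Icc_left (he.1.trans hx.1))))
  have h1 : EqOn y z (Icc s e) := ODE_solution_unique_of_mem_Icc_left (s := fun _ ↦ univ)
    (fun x hx ↦ (hK x (hl (Ioc_subset_Icc_self hx))).lipschitzOnWith)
    (hy.continuousOn.mono hl) (left hy) (fun _ _ ↦ trivial)
    (hz.continuousOn.mono hl) (left hz) (fun _ _ ↦ trivial) h
  have h2 : EqOn y z (Icc e t) := ODE_solution_unique_of_mem_Icc_right (s := fun _ ↦ univ)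
    (fun x hx ↦ (hK x (hr (Ico_subset_Icc_self hx))).lipschitzOnWith)
    (hy.continuousOn.mono hr) (right hy) (fun _ _ ↦ trivial)
    (hz.continuousOn.mono hr) (right hz) (fun _ _ ↦ trivial) h
  intro x hx
  rcases le_total x e with hxe | hxe
  exacts [h1 ⟨hx.1, hxe⟩, h2 ⟨hxe, hx.2⟩]

end ODE

/-! ### Second-derivative test, truncation, and the Bernstein-Nagumo estimate. -/

section Calculus

/-- The second derivative is nonpositive at a local maximum. -/
theorem IsLocalMax.nonpos_of_hasDerivAt {g G : ℝ → ℝ} {x r : ℝ} (h : IsLocalMax g x)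
    (hg : ∀ᶠ y in 𝓝 x, HasDerivAt g (G y) y) (hG : HasDerivAt G r x) : r ≤ 0 := by
  by_contra! hr
  have hd : deriv g =ᶠ[𝓝 x] G := hg.mono fun y hy ↦ hy.deriv
  have hdd : deriv (deriv g) x = r := by rw [hd.deriv_eq, hG.deriv]
  -- If `r > 0`, the point is also a local minimum, so `g` is locally constant and its second
  -- derivative vanishes.
  have hmin : IsLocalMin g x := isLocalMin_of_deriv_deriv_pos (by rw [hdd]; exact hr)
    h.deriv_eq_zero hg.self_of_nhds.continuousAt
  have hconst : g =ᶠ[𝓝 x] fun _ ↦ g x := by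
    filter_upwards [h, hmin] with y h1 h2 using le_antisymm h1 h2
  have : deriv (deriv g) x = 0 := by
    rw [hconst.deriv.deriv_eq]; simp
  linarith

/-- Truncation of `y` to the interval `[l, r]`. -/
def truncate (l r y : ℝ) : ℝ := max l (min r y)

theorem truncate_mem {l r : ℝ} (h : l ≤ r) (y : ℝ) : truncate l r y ∈ Icc l r :=
  ⟨le_max_left _ _, max_le h (min_le_left _ _)⟩

theorem truncate_of_mem {l r y : ℝ} (h : y ∈ Icc l r) : truncate l r y = y := by
  rw [truncate, min_eq_right h.2, max_eq_right h.1]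

theorem truncate_of_le {l r y : ℝ} (h : l ≤ r) (hy : r ≤ y) : truncate l r y = r := by
  rw [truncate, min_eq_left hy, max_eq_right h]

theorem truncate_of_ge {l r y : ℝ} (hy : y ≤ l) : truncate l r y = l :=
  max_eq_left ((min_le_right _ _).trans hy)

theorem abs_truncate_sub_truncate_le (l r y z : ℝ) :
    |truncate l r y - truncate l r z| ≤ |y - z| := by
  unfold truncate
  grind

theorem truncate_neg (M y : ℝ) (hM : 0 ≤ M) : truncate (-M) M (-y) = -truncate (-M) M y := by
  unfold truncate
  grind

/-- A one-sided Bernstein-Nagumo estimate: if `u' = P` is a truncation of `p`, `u` varies by at most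
`D`, and `p'` grows at most quadratically in `P`, then `p` is bounded to the right of any point. -/
theorem le_of_quadratic_growth {u p q : ℝ → ℝ} {s t M K D m : ℝ} (hM : 1 ≤ M)
    (hK : 0 ≤ K)
    (hu : ∀ x ∈ Icc s t, HasDerivWithinAt u (truncate (-M) M (p x)) (Icc s t) x)
    (hp : ∀ x ∈ Icc s t, HasDerivWithinAt p (q x) (Icc s t) x)
    (hD : ∀ x ∈ Icc s t, |u x - u s| ≤ D)
    (hq : ∀ x ∈ Icc s t, |q x| ≤ K * (1 + truncate (-M) M (p x) ^ 2))
    (hm : Real.exp ((2 * K + 1) * D) ≤ m) (hps : p s ≤ m) :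
    ∀ x ∈ Icc s t, p x ≤ m * Real.exp ((2 * K + 1) * D) := by
  set Q := 2 * K + 1 with hQ
  have hQ0 : 0 < Q := by linarith
  have hm0 : 0 < m := (Real.exp_pos _).trans_le hm
  -- A barrier with `B' = Q * P * B`, where `P` is the truncated slope. The condition on `m` gives
  -- `B ≥ 1`, so at a contact point `1 ≤ P ≤ p = B` and `B' ≥ Q * P ^ 2 > 2 * K * P ^ 2 ≥ q`: `p`
  -- cannot cross `B`.
  let B : ℝ → ℝ := fun x ↦ m * Real.exp (Q * (u x - u s))
  have hB : ∀ x ∈ Icc s t,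
      HasDerivWithinAt B (m * (Real.exp (Q * (u x - u s)) * (Q * truncate (-M) M (p x))))
        (Icc s t) x := fun x hx ↦
    ((((hu x hx).sub_const (u s)).const_mul Q).exp).const_mul m
  have hright : ∀ {f : ℝ → ℝ} {f' : ℝ → ℝ}, (∀ x ∈ Icc s t, HasDerivWithinAt f (f' x) (Icc s t) x) →
      ∀ x ∈ Ico s t, HasDerivWithinAt f (f' x) (Ici x) x := fun hf x hx ↦
    (hf x (Ico_subset_Icc_self hx)).mono_of_mem_nhdsWithin
      (mem_of_superset (Ico_mem_nhdsGE hx.2)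
        (Ico_subset_Icc_self.trans (Icc_subset_Icc_left hx.1)))
  have key : ∀ ⦃x⦄, x ∈ Icc s t → p x ≤ B x := by
    refine image_le_of_deriv_right_lt_deriv_boundary' (fun x hx ↦ (hp x hx).continuousWithinAt)
      (hright hp) (by simpa [B] using hps) (fun x hx ↦ (hB x hx).continuousWithinAt)
      (hright hB) ?_
    intro x hx hxB
    have hx' := Ico_subset_Icc_self hx
    have hB1 : 1 ≤ B x := by
      have h1 : -(Q * D) ≤ Q * (u x - u s) := by
        have := (abs_le.1 (hD x hx')).1
        nlinarith
      calc (1 : ℝ) = Real.exp (Q * D) * Real.exp (-(Q * D)) := by rw [← Real.exp_add]; simp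
        _ ≤ m * Real.exp (Q * (u x - u s)) := by gcongr
    have hPp : 1 ≤ truncate (-M) M (p x) ∧ truncate (-M) M (p x) ≤ p x := by
      rw [← hxB] at hB1
      unfold truncate
      grind
    set P := truncate (-M) M (p x)
    have e : m * (Real.exp (Q * (u x - u s)) * (Q * P)) = Q * P * p x := by
      rw [hxB]; simp only [B]; ring
    rw [e]
    have hP1 : 1 ≤ P ^ 2 := one_le_pow₀ hPp.1
    calc q x ≤ K * (1 + P ^ 2) := (le_abs_self _).trans (hq x hx')
      _ ≤ K * (P ^ 2 + P ^ 2) := by gcongr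
      _ < Q * P * P := by rw [hQ]; linarith
      _ ≤ Q * P * p x := mul_le_mul_of_nonneg_left hPp.2 (mul_nonneg hQ0.le (by linarith))
  intro x hx
  refine (key hx).trans ?_
  have : u x - u s ≤ D := (le_abs_self _).trans (hD x hx)
  simp only [B]
  gcongr

theorem abs_le_of_quadratic_growth_right {u p q : ℝ → ℝ} {s t M K D m : ℝ}
    (hM : 1 ≤ M) (hK : 0 ≤ K)
    (hu : ∀ x ∈ Icc s t, HasDerivWithinAt u (truncate (-M) M (p x)) (Icc s t) x)
    (hp : ∀ x ∈ Icc s t, HasDerivWithinAt p (q x) (Icc s t) x)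
    (hD : ∀ x ∈ Icc s t, |u x - u s| ≤ D)
    (hq : ∀ x ∈ Icc s t, |q x| ≤ K * (1 + truncate (-M) M (p x) ^ 2))
    (hm : Real.exp ((2 * K + 1) * D) ≤ m) (hps : |p s| ≤ m) :
    ∀ x ∈ Icc s t, |p x| ≤ m * Real.exp ((2 * K + 1) * D) := by
  intro x hx
  refine abs_le'.2 ⟨le_of_quadratic_growth hM hK hu hp hD hq hm (abs_le'.1 hps).1 x hx, ?_⟩
  have hM0 : 0 ≤ M := by linarith
  refine le_of_quadratic_growth (u := fun x ↦ -u x) (p := fun x ↦ -p x) (q := fun x ↦ -q x) hM hK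
    (fun x hx ↦ ?_) (fun x hx ↦ (hp x hx).neg) (fun x hx ↦ ?_) (fun x hx ↦ ?_) hm (abs_le'.1 hps).2
    x hx
  · rw [truncate_neg _ _ hM0]; exact (hu x hx).neg
  · rw [show -u x - -u s = -(u x - u s) by ring, abs_neg]; exact hD x hx
  · rw [truncate_neg _ _ hM0, abs_neg, neg_sq]; exact hq x hx

theorem hasDerivWithinAt_comp_neg {f : ℝ → ℝ} {f' s t x : ℝ}
    (h : HasDerivWithinAt f f' (Icc s t) (-x)) :
    HasDerivWithinAt (fun x ↦ f (-x)) (-f') (Icc (-t) (-s)) x := by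
  have := h.scomp x (hasDerivAt_neg x).hasDerivWithinAt (s := Icc (-t) (-s))
    (fun y hy ↦ ⟨le_neg.1 hy.2, neg_le.1 hy.1⟩)
  simpa [Function.comp_def] using this

/-- The reflection `x ↦ -x` replaces the slope `p x` by `-p (-x)` and preserves the growth
condition, which reduces this to the estimate to the right. -/
theorem abs_le_of_quadratic_growth_left {u p q : ℝ → ℝ} {s t M K D m : ℝ}
    (hM : 1 ≤ M) (hK : 0 ≤ K)
    (hu : ∀ x ∈ Icc s t, HasDerivWithinAt u (truncate (-M) M (p x)) (Icc s t) x)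
    (hp : ∀ x ∈ Icc s t, HasDerivWithinAt p (q x) (Icc s t) x)
    (hD : ∀ x ∈ Icc s t, |u x - u t| ≤ D)
    (hq : ∀ x ∈ Icc s t, |q x| ≤ K * (1 + truncate (-M) M (p x) ^ 2))
    (hm : Real.exp ((2 * K + 1) * D) ≤ m) (hpt : |p t| ≤ m) :
    ∀ x ∈ Icc s t, |p x| ≤ m * Real.exp ((2 * K + 1) * D) := by
  have hM0 : 0 ≤ M := by linarith
  have hmem : ∀ x ∈ Icc (-t) (-s), -x ∈ Icc s t := fun y hy ↦ ⟨le_neg.1 hy.2, neg_le.1 hy.1⟩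
  have := abs_le_of_quadratic_growth_right (u := fun x ↦ u (-x)) (p := fun x ↦ -p (-x))
    (q := fun x ↦ q (-x)) (s := -t) (t := -s) hM hK (fun x hx ↦ ?_) (fun x hx ↦ ?_)
    (fun x hx ↦ ?_) (fun x hx ↦ ?_) hm (by simpa using hpt)
  · intro x hx
    simpa using this (-x) ⟨neg_le_neg hx.2, neg_le_neg hx.1⟩
  · rw [truncate_neg _ _ hM0]
    exact hasDerivWithinAt_comp_neg (hu (-x) (hmem x hx))
  · have := (hasDerivWithinAt_comp_neg (hp (-x) (hmem x hx))).neg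
    rw [neg_neg] at this
    exact this
  · simpa using hD (-x) (hmem x hx)
  · rw [truncate_neg _ _ hM0, neg_sq]
    exact hq (-x) (hmem x hx)

/-- The **Bernstein-Nagumo estimate**: a bound on `p`, independent of the truncation level `M`. -/
theorem exists_bound_of_quadratic_growth {s t K D : ℝ} (hst : s < t) (hK : 0 ≤ K) (hD : 0 ≤ D) :
    ∃ M₀ : ℝ, ∀ (M : ℝ) (u p q : ℝ → ℝ), M₀ < M →
      (∀ x ∈ Icc s t, HasDerivWithinAt u (truncate (-M) M (p x)) (Icc s t) x) →
      (∀ x ∈ Icc s t, HasDerivWithinAt p (q x) (Icc s t) x) →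
      (∀ x ∈ Icc s t, ∀ y ∈ Icc s t, |u x - u y| ≤ D) →
      (∀ x ∈ Icc s t, |q x| ≤ K * (1 + truncate (-M) M (p x) ^ 2)) →
      ∀ x ∈ Icc s t, |p x| ≤ M₀ := by
  set m := max (Real.exp ((2 * K + 1) * D)) (D / (t - s))
  have hm1 : Real.exp ((2 * K + 1) * D) ≤ m := le_max_left _ _
  have he : 1 ≤ Real.exp ((2 * K + 1) * D) := Real.one_le_exp (by positivity)
  refine ⟨m * Real.exp ((2 * K + 1) * D), fun M u p q hM hu hp hDu hq x hx ↦ ?_⟩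
  have hmM : m < M := (le_mul_of_one_le_right (by linarith) he).trans_lt hM
  -- The mean value theorem supplies a point where the truncated slope is at most `D / (t - s)`; as
  -- `m < M`, it is the true slope there, and the one-sided estimates spread the bound in both
  -- directions.
  obtain ⟨z, hz, hz'⟩ := exists_hasDerivAt_eq_slope u (fun x ↦ truncate (-M) M (p x)) hst
    (fun x hx ↦ (hu x hx).continuousWithinAt)
    (fun x hx ↦ (hu x (Ioo_subset_Icc_self hx)).hasDerivAt (Icc_mem_nhds hx.1 hx.2))
  have hPz : |truncate (-M) M (p z)| ≤ m := by
    rw [hz', abs_div, abs_of_pos (sub_pos.2 hst)]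
    exact (div_le_div_of_nonneg_right (hDu t ⟨hst.le, le_rfl⟩ s ⟨le_rfl, hst.le⟩)
      (sub_pos.2 hst).le).trans (le_max_right _ _)
  have hpz : |p z| ≤ m := by
    have h1 := abs_le.1 hPz
    have : truncate (-M) M (p z) = p z := by
      revert h1
      unfold truncate
      grind
    rwa [← this]
  have hz1 := Ioo_subset_Icc_self hz
  have hl : Icc s z ⊆ Icc s t := Icc_subset_Icc_right hz1.2
  have hr : Icc z t ⊆ Icc s t := Icc_subset_Icc_left hz1.1
  have hM1 : 1 ≤ M := by linarith
  rcases le_total x z with hxz | hxz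
  · exact abs_le_of_quadratic_growth_left hM1 hK (fun y hy ↦ (hu y (hl hy)).mono hl)
      (fun y hy ↦ (hp y (hl hy)).mono hl) (fun y hy ↦ hDu y (hl hy) z hz1) (fun y hy ↦ hq y (hl hy))
      hm1 hpz x ⟨hx.1, hxz⟩
  · exact abs_le_of_quadratic_growth_right hM1 hK (fun y hy ↦ (hu y (hr hy)).mono hr)
      (fun y hy ↦ (hp y (hr hy)).mono hr) (fun y hy ↦ hDu y (hr hy) z hz1) (fun y hy ↦ hq y (hr hy))
      hm1 hpz x ⟨hxz, hx.2⟩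

end Calculus

/-! ### The first-order system and its truncation. -/

/-- The right-hand side of the equation solved for the second derivative. -/
noncomputable def singularRHS (a b c x u p : ℝ) : ℝ := (a * x * p + b * u - c * (p - 1) ^ 2) / x ^ 2

/-- The first-order system equivalent to the equation. -/
noncomputable def singularField (a b c x : ℝ) (z : ℝ × ℝ) : ℝ × ℝ :=
  (z.2, singularRHS a b c x z.1 z.2)

/-- A bounded Lipschitz modification of `singularField`: the value is truncated to `[0, x]`, the
slope to `[-M, M]`, and a penalty drives solutions of boundary value problems back into the strip. -/
noncomputable def truncatedField (a b c M x : ℝ) (z : ℝ × ℝ) : ℝ × ℝ :=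
  (truncate (-M) M z.2, singularRHS a b c x (truncate 0 x z.1) (truncate (-M) M z.2) +
    truncate (-1) 1 (z.1 - truncate 0 x z.1))

section Field

variable {a b c s t M : ℝ}

/-- This is the Nagumo growth condition; `s > 0` keeps the factor `1 / x ^ 2` bounded. -/
theorem exists_singularRHS_bound (a b : ℝ) {c s t : ℝ} (hc : 0 ≤ c) (hs : 0 < s) (hst : s ≤ t) :
    ∃ K, 0 ≤ K ∧ ∀ x ∈ Icc s t, ∀ u ∈ Icc 0 x, ∀ p, |singularRHS a b c x u p| ≤ K * (1 + p ^ 2) := by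
  have ht : 0 < t := hs.trans_le hst
  refine ⟨(|a| * t + |b| * t + 2 * c) / s ^ 2, by positivity, fun x hx u hu p ↦ ?_⟩
  have hx0 : 0 < x := hs.trans_le hx.1
  rw [singularRHS, abs_div, abs_of_pos (pow_pos hx0 2), div_mul_eq_mul_div]
  have h1 : |a * x * p| ≤ |a| * t * (1 + p ^ 2) := by
    rw [abs_mul, abs_mul, abs_of_pos hx0]
    have : |p| ≤ 1 + p ^ 2 := by rw [← sq_abs]; nlinarith [sq_nonneg (|p| - 1), abs_nonneg p]
    exact mul_le_mul (mul_le_mul_of_nonneg_left hx.2 (abs_nonneg _)) this (abs_nonneg _)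
      (by positivity)
  have h2 : |b * u| ≤ |b| * t * (1 + p ^ 2) := by
    rw [abs_mul, abs_of_nonneg hu.1]
    refine (mul_le_mul_of_nonneg_left (hu.2.trans hx.2) (abs_nonneg b)).trans ?_
    exact le_mul_of_one_le_right (by positivity) (by nlinarith)
  have h3 : |c * (p - 1) ^ 2| ≤ 2 * c * (1 + p ^ 2) := by
    rw [abs_of_nonneg (by positivity)]
    nlinarith [mul_nonneg hc (sq_nonneg (p + 1))]
  gcongr
  · calc _ ≤ |a * x * p| + |b * u| + |c * (p - 1) ^ 2| :=
          (abs_sub _ _).trans (add_le_add_left (abs_add_le _ _) _)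
      _ ≤ _ := by linarith
  · exact hx.1

theorem exists_norm_truncatedField_le (a b : ℝ) {c s t : ℝ} (hc : 0 ≤ c) (hs : 0 < s) (hst : s ≤ t)
    (hM : 0 ≤ M) : ∃ L, ∀ x ∈ Icc s t, ∀ z, ‖truncatedField a b c M x z‖ ≤ L := by
  obtain ⟨K, hK0, hK⟩ := exists_singularRHS_bound a b hc hs hst
  refine ⟨max M (K * (1 + M ^ 2) + 1), fun x hx z ↦ ?_⟩
  have hx0 : 0 ≤ x := hs.le.trans hx.1
  have hP : |truncate (-M) M z.2| ≤ M := abs_le.2 (truncate_mem (by linarith) _)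
  refine max_le_max hP ((abs_add_le _ _).trans (add_le_add ?_ ?_))
  · refine (hK x hx _ (truncate_mem hx0 _) _).trans ?_
    have := sq_le_sq' (abs_le.1 hP).1 (abs_le.1 hP).2
    gcongr
  · exact abs_le.2 (truncate_mem (by norm_num) _)

theorem abs_singularRHS_sub_le (hc : 0 ≤ c) (hs : 0 < s) {x u u' p p' : ℝ}
    (hx : x ∈ Icc s t) (hp : |p| ≤ M) (hp' : |p'| ≤ M) :
    |singularRHS a b c x u p - singularRHS a b c x u' p'| ≤
      ((|a| * t + 2 * c * (M + 1)) * |p - p'| + |b| * |u - u'|) / s ^ 2 := by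
  have hx0 : 0 < x := hs.trans_le hx.1
  have ht : 0 ≤ t := hx0.le.trans hx.2
  have hM : 0 ≤ M := (abs_nonneg p).trans hp
  rw [singularRHS, singularRHS, ← sub_div, abs_div, abs_of_pos (pow_pos hx0 2)]
  have e : a * x * p + b * u - c * (p - 1) ^ 2 - (a * x * p' + b * u' - c * (p' - 1) ^ 2)
      = (a * x - c * (p + p' - 2)) * (p - p') + b * (u - u') := by ring
  have h : |a * x - c * (p + p' - 2)| ≤ |a| * t + 2 * c * (M + 1) := by
    refine (abs_sub _ _).trans (add_le_add ?_ ?_)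
    · rw [abs_mul, abs_of_pos hx0]
      exact mul_le_mul_of_nonneg_left hx.2 (abs_nonneg _)
    · rw [abs_mul, abs_of_nonneg hc, mul_comm 2 c, mul_assoc]
      refine mul_le_mul_of_nonneg_left ?_ hc
      rw [abs_le] at *
      constructor <;> linarith
  gcongr
  · rw [e]
    refine (abs_add_le _ _).trans ?_
    rw [abs_mul, abs_mul]
    gcongr
  · exact hx.1

theorem exists_lipschitzWith_truncatedField (a b : ℝ) {c s t : ℝ} (hc : 0 ≤ c) (hs : 0 < s)
    (hst : s ≤ t) (hM : 0 ≤ M) :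
    ∃ K : ℝ≥0, ∀ x ∈ Icc s t, LipschitzWith K (truncatedField a b c M x) := by
  have ht : 0 < t := hs.trans_le hst
  -- The summand `2` accounts for the penalty, a truncation of the difference of two 1-Lipschitz
  -- functions of the value.
  have hC : 0 ≤ (|a| * t + 2 * c * (M + 1) + |b|) / s ^ 2 + 2 := by positivity
  refine ⟨.mk (1 + ((|a| * t + 2 * c * (M + 1) + |b|) / s ^ 2 + 2)) (by positivity), fun x hx ↦
    LipschitzWith.of_dist_le_mul fun z w ↦ ?_⟩
  rw [NNReal.coe_mk]
  set C := (|a| * t + 2 * c * (M + 1) + |b|) / s ^ 2 + 2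
  have h1 : |z.1 - w.1| ≤ dist z w := le_max_left (dist z.1 w.1) (dist z.2 w.2)
  have h2 : |z.2 - w.2| ≤ dist z w := le_max_right (dist z.1 w.1) (dist z.2 w.2)
  have hd : 0 ≤ dist z w := dist_nonneg
  have hP (y : ℝ) : |truncate (-M) M y| ≤ M := abs_le.2 (truncate_mem (by linarith) _)
  have hp := (abs_truncate_sub_truncate_le (-M) M z.2 w.2).trans h2
  have hu := (abs_truncate_sub_truncate_le 0 x z.1 w.1).trans h1
  refine max_le ?_ ?_
  · rw [Real.dist_eq]
    exact hp.trans (le_mul_of_one_le_left hd (by linarith))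
  · have hf := abs_singularRHS_sub_le (a := a) (b := b) (u := truncate 0 x z.1)
      (u' := truncate 0 x w.1) hc hs hx (hP z.2) (hP w.2)
    have hpen := abs_truncate_sub_truncate_le (-1) 1 (z.1 - truncate 0 x z.1)
      (w.1 - truncate 0 x w.1)
    have hpen2 : |z.1 - truncate 0 x z.1 - (w.1 - truncate 0 x w.1)| ≤ 2 * dist z w := by
      rw [show z.1 - truncate 0 x z.1 - (w.1 - truncate 0 x w.1)
        = (z.1 - w.1) - (truncate 0 x z.1 - truncate 0 x w.1) by ring]
      exact (abs_sub _ _).trans (by linarith)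
    have hf2 : ((|a| * t + 2 * c * (M + 1)) * |truncate (-M) M z.2 - truncate (-M) M w.2| +
        |b| * |truncate 0 x z.1 - truncate 0 x w.1|) / s ^ 2 ≤
        ((|a| * t + 2 * c * (M + 1) + |b|) / s ^ 2) * dist z w := by
      rw [div_mul_eq_mul_div, add_mul (_ + _)]
      gcongr
    rw [Real.dist_eq]
    simp only [truncatedField]
    rw [add_sub_add_comm]
    refine (abs_add_le _ _).trans ?_
    have : (1 + C) * dist z w = dist z w + ((|a| * t + 2 * c * (M + 1) + |b|) / s ^ 2) * dist z w
      + 2 * dist z w := by simp only [C]; ring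
    linarith

theorem continuousOn_truncatedField (hs : 0 < s) (z : ℝ × ℝ) :
    ContinuousOn (fun x ↦ truncatedField a b c M x z) (Icc s t) := by
  have h : Continuous fun x : ℝ ↦ truncate 0 x z.1 := by unfold truncate; fun_prop
  have h' : Continuous fun x : ℝ ↦ truncate (-1) 1 (z.1 - truncate 0 x z.1) := by
    unfold truncate; fun_prop
  unfold truncatedField singularRHS
  refine continuousOn_const.prodMk (ContinuousOn.add (ContinuousOn.div ?_ ?_ ?_) h'.continuousOn)
  · fun_prop
  · fun_prop
  · intro x hx
    exact (pow_pos (hs.trans_le hx.1) 2).ne'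

/-! ### A priori slope bounds and the maximum principle. -/

/-- The curves that stay in the strip `0 ≤ u ≤ x`. -/
def InStrip (y : ℝ → ℝ × ℝ) (I : Set ℝ) : Prop := ∀ x ∈ I, (y x).1 ∈ Icc 0 x

theorem IsIntegralCurveOn.fst {y : ℝ → ℝ × ℝ} {v : ℝ → ℝ × ℝ → ℝ × ℝ} {I : Set ℝ}
    (h : IsIntegralCurveOn y v I) {x : ℝ} (hx : x ∈ I) :
    HasDerivWithinAt (fun x ↦ (y x).1) (v x (y x)).1 I x := by
  have := (h x hx).hasFDerivWithinAt.fst.hasDerivWithinAt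
  simpa using this

theorem IsIntegralCurveOn.snd {y : ℝ → ℝ × ℝ} {v : ℝ → ℝ × ℝ → ℝ × ℝ} {I : Set ℝ}
    (h : IsIntegralCurveOn y v I) {x : ℝ} (hx : x ∈ I) :
    HasDerivWithinAt (fun x ↦ (y x).2) (v x (y x)).2 I x := by
  have := (h x hx).hasFDerivWithinAt.snd.hasDerivWithinAt
  simpa using this

theorem truncatedField_eq_of_mem {x : ℝ} {z : ℝ × ℝ} (h : z.1 ∈ Icc 0 x) :
    truncatedField a b c M x z =
      (truncate (-M) M z.2, singularRHS a b c x z.1 (truncate (-M) M z.2)) := by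
  rw [truncatedField, truncate_of_mem h, sub_self,
    truncate_of_mem (show (0 : ℝ) ∈ Icc (-1) 1 by norm_num), add_zero]

theorem truncatedField_eq_singularField {x : ℝ} {z : ℝ × ℝ} (h : z.1 ∈ Icc 0 x) (h' : |z.2| ≤ M) :
    truncatedField a b c M x z = singularField a b c x z := by
  rw [truncatedField_eq_of_mem h, truncate_of_mem (abs_le.1 h'), singularField]

/-- In the strip the value oscillates by at most `t`, so the Bernstein-Nagumo estimate applies.
Since `M₀` is chosen before `M`, a larger `M` makes the slope truncation invisible. -/
theorem exists_slope_bound (a b : ℝ) {c s t : ℝ} (hc : 0 ≤ c) (hs : 0 < s) (hst : s < t) :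
    ∃ M₀ : ℝ, ∀ (M : ℝ) (y : ℝ → ℝ × ℝ), M₀ < M →
      IsIntegralCurveOn y (truncatedField a b c M) (Icc s t) → InStrip y (Icc s t) →
      ∀ x ∈ Icc s t, |(y x).2| ≤ M₀ := by
  obtain ⟨K, hK0, hK⟩ := exists_singularRHS_bound a b hc hs hst.le
  obtain ⟨M₀, h⟩ := exists_bound_of_quadratic_growth hst hK0 (hs.trans hst).le
  refine ⟨M₀, fun M y hM hy hS ↦ h M (fun x ↦ (y x).1) (fun x ↦ (y x).2)
    (fun x ↦ singularRHS a b c x (y x).1 (truncate (-M) M (y x).2)) hM (fun x hx ↦ ?_)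
    (fun x hx ↦ ?_) (fun x hx z hz ↦ ?_) fun x hx ↦ hK x hx _ (hS x hx) _⟩
  · have := hy.fst hx
    rwa [truncatedField_eq_of_mem (hS x hx)] at this
  · have := hy.snd hx
    rwa [truncatedField_eq_of_mem (hS x hx)] at this
  · have h1 := hS x hx
    have h2 := hS z hz
    exact abs_sub_le_of_nonneg_of_le h1.1 (h1.2.trans hx.2) h2.1 (h2.2.trans hz.2)

theorem exists_slope_bound_singularField (a b : ℝ) {c s t : ℝ} (hc : 0 ≤ c) (hs : 0 < s)
    (hst : s < t) : ∃ M₀ : ℝ, ∀ y : ℝ → ℝ × ℝ,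
      IsIntegralCurveOn y (singularField a b c) (Icc s t) → InStrip y (Icc s t) →
      ∀ x ∈ Icc s t, |(y x).2| ≤ M₀ := by
  obtain ⟨M₀, h⟩ := exists_slope_bound a b hc hs hst
  refine ⟨M₀, fun y hy hS ↦ ?_⟩
  obtain ⟨C, hC⟩ := isCompact_Icc.exists_bound_of_continuousOn
    (fun x hx ↦ (hy.snd hx).continuousWithinAt)
  -- The curve has some slope bound `C` by compactness, hence solves the system truncated at any
  -- level above `C`; the resulting bound `M₀` does not depend on `C`.
  refine h (max C (M₀ + 1)) y (by simp) (fun x hx ↦ ?_) hS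
  rw [truncatedField_eq_singularField (hS x hx) ((hC x hx).trans (le_max_left _ _))]
  exact hy x hx

/-- Maximum principle: solutions of the truncated system with boundary values in the strip stay in
the strip. -/
theorem IsIntegralCurveOn.inStrip (hab : 0 ≤ a + b) (hc : 0 ≤ c) (hs : 0 < s) (hst : s ≤ t)
    (hM : 1 < M) {y : ℝ → ℝ × ℝ} (hy : IsIntegralCurveOn y (truncatedField a b c M) (Icc s t))
    (hys : (y s).1 ∈ Icc 0 s) (hyt : (y t).1 ∈ Icc 0 t) : InStrip y (Icc s t) := by
  have hcu : ContinuousOn (fun x ↦ (y x).1) (Icc s t) := fun x hx ↦ (hy.fst hx).continuousWithinAt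
  have hne : (Icc s t).Nonempty := nonempty_Icc.2 hst
  have hd1 : ∀ x ∈ Ioo s t, ∀ᶠ z in 𝓝 x,
      HasDerivAt (fun x ↦ (y x).1) (truncate (-M) M (y z).2) z := fun x hx ↦ by
    filter_upwards [Ioo_mem_nhds hx.1 hx.2] with z hz
    exact (hy.fst (Ioo_subset_Icc_self hz)).hasDerivAt (Icc_mem_nhds hz.1 hz.2)
  have hd2 : ∀ x ∈ Ioo s t, HasDerivAt (fun x ↦ (y x).2) (truncatedField a b c M x (y x)).2 x :=
    fun x hx ↦ (hy.snd (Ioo_subset_Icc_self hx)).hasDerivAt (Icc_mem_nhds hx.1 hx.2)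
  have htr : ∀ x ∈ Ioo s t, |(y x).2| < M →
      HasDerivAt (fun x ↦ truncate (-M) M (y x).2) (truncatedField a b c M x (y x)).2 x := by
    intro x hx hp
    refine (hd2 x hx).congr_of_eventuallyEq ?_
    filter_upwards [(hd2 x hx).continuousAt.abs.eventually_lt continuousAt_const hp] with z hz
    exact truncate_of_mem (abs_le.1 hz.le)
  have hslope : ∀ x, ∀ r ∈ Ioo (-M) M, truncate (-M) M (y x).2 = r → (y x).2 = r := by
    intro x r hr h
    revert h
    unfold truncate
    grind
  intro x hx
  constructor
  -- At a negative interior minimum the slope is `0` and the second derivative is `-c / z ^ 2` plus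
  -- a negative penalty. The penalty makes the contradiction strict.
  · obtain ⟨z, hz, hmin⟩ := isCompact_Icc.exists_isMinOn hne hcu
    by_contra! hneg
    have hz0 : (y z).1 < 0 := (hmin hx).trans_lt hneg
    have hzs : z ≠ s := by rintro rfl; linarith [hys.1]
    have hzt : z ≠ t := by rintro rfl; linarith [hyt.1]
    have hz' : z ∈ Ioo s t := ⟨lt_of_le_of_ne hz.1 hzs.symm, lt_of_le_of_ne hz.2 hzt⟩
    have hz0' : 0 < z := hs.trans hz'.1
    have hloc : IsLocalMin (fun x ↦ (y x).1) z := hmin.isLocalMin (Icc_mem_nhds hz'.1 hz'.2)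
    have hP : truncate (-M) M (y z).2 = 0 :=
      hloc.hasDerivAt_eq_zero (hd1 z hz').self_of_nhds
    have hp := hslope z 0 ⟨by linarith, by linarith⟩ hP
    have hr := hloc.neg.nonpos_of_hasDerivAt ((hd1 z hz').mono fun w hw ↦ hw.neg)
      (htr z hz' (by rw [hp, abs_zero]; linarith)).neg
    have hval : (truncatedField a b c M z (y z)).2 = -(c / z ^ 2) + truncate (-1) 1 (y z).1 := by
      simp only [truncatedField]
      rw [hP, truncate_of_ge hz0.le, singularRHS]
      ring_nf
    have hpen : truncate (-1) 1 (y z).1 < 0 := by unfold truncate; grind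
    have : 0 ≤ c / z ^ 2 := by positivity
    rw [hval] at hr
    linarith
  -- At a positive interior maximum of `u - x` the slope is `1`, which `M > 1` leaves untruncated,
  -- and the second derivative is `(a + b) / z` plus a positive penalty.
  · obtain ⟨z, hz, hmax⟩ := isCompact_Icc.exists_isMaxOn hne (hcu.sub continuousOn_id)
    by_contra! hneg
    have hz0 : z < (y z).1 := by
      have : (y x).1 - x ≤ (y z).1 - z := hmax hx
      linarith
    have hzs : z ≠ s := by rintro rfl; linarith [hys.2]
    have hzt : z ≠ t := by rintro rfl; linarith [hyt.2]
    have hz' : z ∈ Ioo s t := ⟨lt_of_le_of_ne hz.1 hzs.symm, lt_of_le_of_ne hz.2 hzt⟩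
    have hz0' : 0 < z := hs.trans hz'.1
    have hloc : IsLocalMax (fun x ↦ (y x).1 - x) z := hmax.isLocalMax (Icc_mem_nhds hz'.1 hz'.2)
    have hd : ∀ᶠ w in 𝓝 z, HasDerivAt (fun x ↦ (y x).1 - x) (truncate (-M) M (y w).2 - 1) w :=
      (hd1 z hz').mono fun w hw ↦ hw.sub (hasDerivAt_id w)
    have hP : truncate (-M) M (y z).2 = 1 := by
      linarith [hloc.hasDerivAt_eq_zero hd.self_of_nhds]
    have hp := hslope z 1 ⟨by linarith, by linarith⟩ hP
    have hr := hloc.nonpos_of_hasDerivAt hd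
      ((htr z hz' (by rw [hp, abs_one]; linarith)).sub_const 1)
    have hval : (truncatedField a b c M z (y z)).2 =
        (a + b) * z / z ^ 2 + truncate (-1) 1 ((y z).1 - z) := by
      simp only [truncatedField]
      rw [hP, truncate_of_le hz0'.le hz0.le, singularRHS]
      ring_nf
    have hpen : 0 < truncate (-1) 1 ((y z).1 - z) := by unfold truncate; grind
    have : 0 ≤ (a + b) * z / z ^ 2 := by positivity
    rw [hval] at hr
    linarith

end Field

/-! ### Boundary value problems in the strip and passage to the singular point. -/

section BoundaryValue

variable {a b c s t M : ℝ}

/-- With a steep terminal slope, the truncated system has a solution component of constant slope. -/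
theorem IsIntegralCurveOn.fst_left_eq_of_truncate_eq (hst : s ≤ t) {y : ℝ → ℝ × ℝ} {r : ℝ}
    (hy : IsIntegralCurveOn y (truncatedField a b c M) (Icc s t))
    (hr : ∀ x ∈ Icc s t, truncate (-M) M (y x).2 = r) : (y s).1 = (y t).1 - r * (t - s) := by
  have h : ∀ x ∈ Icc s t, HasDerivWithinAt (fun x ↦ (y x).1 - r * x) 0 (Icc s t) x := fun x hx ↦ by
    have h1 := (hy.fst hx).sub (((hasDerivWithinAt_id x (Icc s t)).const_mul r))
    have e : (truncatedField a b c M x (y x)).1 - r * 1 = 0 := by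
      simp only [truncatedField]; rw [hr x hx]; ring
    rw [e] at h1
    exact h1
  have := (convex_Icc s t).norm_image_sub_le_of_norm_hasDerivWithin_le (C := 0) h (by simp)
    (left_mem_Icc.2 hst) (right_mem_Icc.2 hst)
  have h0 := norm_le_zero_iff.1 (this.trans_eq (zero_mul _))
  linarith

/-- The boundary value problem `u s = 0`, `u t = ξ` has a solution in the strip, by shooting from
the right end point. -/
theorem exists_strip_solution_Icc (hab : 0 ≤ a + b) (hc : 0 ≤ c) (hs : 0 < s) (hst : s < t) {ξ : ℝ}
    (hξ : ξ ∈ Icc 0 t) : ∃ y : ℝ → ℝ × ℝ, IsIntegralCurveOn y (singularField a b c) (Icc s t) ∧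
      InStrip y (Icc s t) ∧ (y t).1 = ξ := by
  have hts : 0 < t - s := sub_pos.2 hst
  have ht : t ∈ Icc s t := right_mem_Icc.2 hst.le
  have hs' : s ∈ Icc s t := left_mem_Icc.2 hst.le
  obtain ⟨M₀, hM₀⟩ := exists_slope_bound a b hc hs hst
  -- The three lower bounds serve to deactivate the slope truncation, to apply the maximum
  -- principle, and to make a line of slope `M` through `(t, ξ)` negative at `s`.
  obtain ⟨M, hM⟩ := exists_gt (max M₀ (max 1 (t / (t - s))))
  simp only [max_lt_iff] at hM
  obtain ⟨hMM₀, hM1, hMt⟩ := hM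
  rw [div_lt_iff₀ hts] at hMt
  have hM0 : 0 ≤ M := by linarith
  obtain ⟨L, hL⟩ := exists_norm_truncatedField_le a b hc hs hst.le hM0
  obtain ⟨K, hK⟩ := exists_lipschitzWith_truncatedField a b hc hs hst.le hM0
  have hL0 : 0 ≤ L := (norm_nonneg _).trans (hL s hs' 0)
  -- The slope varies by at most `L * (t - s)`, so from terminal slope `±P` it stays beyond `±M`:
  -- the value component is then a line of slope `±M`, and `u s` has opposite signs in the two
  -- cases.
  set P := M + L * (t - s)
  have hP0 : 0 ≤ P := by positivity
  obtain ⟨Φ, hΦ, hΦc⟩ := exists_flow_of_bounded_of_lipschitz ht hK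
    (continuousOn_truncatedField hs) hL (t + P)
  have hball : ∀ p ∈ Icc (-P) P, (ξ, p) ∈ closedBall (0 : ℝ × ℝ) (t + P) := fun p hp ↦ by
    rw [mem_closedBall_zero_iff]
    refine max_le ?_ ?_
    · rw [Real.norm_eq_abs, abs_of_nonneg hξ.1]; linarith [hξ.2]
    · rw [Real.norm_eq_abs]; linarith [abs_le.2 hp, ht.1]
  have hslope : ∀ p ∈ Icc (-P) P, ∀ x ∈ Icc s t, |(Φ (ξ, p) x).2 - p| ≤ L * (t - s) := by
    intro p hp x hx
    obtain ⟨h0, h1⟩ := hΦ _ (hball p hp)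
    have := (convex_Icc s t).norm_image_sub_le_of_norm_hasDerivWithin_le (fun x hx ↦ h1.snd hx)
      (fun x hx ↦ (norm_snd_le _).trans (hL x hx _)) ht hx
    rw [h0] at this
    refine this.trans (mul_le_mul_of_nonneg_left ?_ hL0)
    rw [Real.norm_eq_abs, abs_le]
    constructor <;> linarith [hx.1, hx.2]
  have hcont : ContinuousOn (fun p ↦ (Φ (ξ, p) s).1) (Icc (-P) P) :=
    continuous_fst.comp_continuousOn ((hΦc s hs').comp (by fun_prop) hball)
  have hPm : P ∈ Icc (-P) P := ⟨by linarith, le_rfl⟩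
  have hPm' : -P ∈ Icc (-P) P := ⟨le_rfl, by linarith⟩
  have hup : (Φ (ξ, P) s).1 ≤ 0 := by
    obtain ⟨h0, h1⟩ := hΦ _ (hball P hPm)
    rw [h1.fst_left_eq_of_truncate_eq hst.le (r := M) fun x hx ↦ ?_, h0]
    · simp only; linarith [hξ.2]
    · exact truncate_of_le (by linarith) (by linarith [(abs_le.1 (hslope P hPm x hx)).1])
  have hdown : 0 ≤ (Φ (ξ, -P) s).1 := by
    obtain ⟨h0, h1⟩ := hΦ _ (hball (-P) hPm')
    rw [h1.fst_left_eq_of_truncate_eq hst.le (r := -M) fun x hx ↦ ?_, h0]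
    · simp only; linarith [hξ.1, mul_nonneg hM0 hts.le]
    · exact truncate_of_ge (by linarith [(abs_le.1 (hslope (-P) hPm' x hx)).2])
  obtain ⟨p, hp, hp0⟩ := intermediate_value_Icc' (by linarith) hcont ⟨hup, hdown⟩
  obtain ⟨h0, h1⟩ := hΦ _ (hball p hp)
  have hS : InStrip (Φ (ξ, p)) (Icc s t) := h1.inStrip hab hc hs hst.le hM1
    (by simp only at hp0; rw [hp0]; exact ⟨le_rfl, hs.le⟩) (by rw [h0]; exact hξ)
  refine ⟨Φ (ξ, p), fun x hx ↦ ?_, hS, by rw [h0]⟩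
  rw [← truncatedField_eq_singularField (M := M) (hS x hx)
    ((hM₀ M _ hMM₀ h1 hS x hx).trans hMM₀.le)]
  exact h1 x hx

/-- The initial data at `e` of solutions on `[s, t]` in the strip. -/
def stripData (a b c s t e : ℝ) : Set (ℝ × ℝ) :=
  {z | ∃ y : ℝ → ℝ × ℝ, IsIntegralCurveOn y (singularField a b c) (Icc s t) ∧
    InStrip y (Icc s t) ∧ y e = z}

theorem stripData_subset {s' t' e : ℝ} (h : Icc s' t' ⊆ Icc s t) :
    stripData a b c s t e ⊆ stripData a b c s' t' e := by
  rintro z ⟨y, hy, hS, rfl⟩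
  exact ⟨y, hy.mono h, fun x hx ↦ hS x (h hx), rfl⟩

/-- `singularField` is not globally Lipschitz in the slope, but strip solutions share a slope bound
`M` and so solve the same Lipschitz truncated system. -/
theorem strip_solution_unique (hc : 0 ≤ c) (hs : 0 < s) (hst : s < t) {e : ℝ} (he : e ∈ Icc s t)
    {y z : ℝ → ℝ × ℝ} (hy : IsIntegralCurveOn y (singularField a b c) (Icc s t))
    (hyS : InStrip y (Icc s t)) (hz : IsIntegralCurveOn z (singularField a b c) (Icc s t))
    (hzS : InStrip z (Icc s t)) (h : y e = z e) : EqOn y z (Icc s t) := by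
  obtain ⟨M, hM⟩ := exists_slope_bound_singularField a b hc hs hst
  have hM0 : 0 ≤ M := (abs_nonneg _).trans (hM y hy hyS e he)
  obtain ⟨K, hK⟩ := exists_lipschitzWith_truncatedField a b hc hs hst.le hM0
  have htr : ∀ {w : ℝ → ℝ × ℝ}, IsIntegralCurveOn w (singularField a b c) (Icc s t) →
      InStrip w (Icc s t) → IsIntegralCurveOn w (truncatedField a b c M) (Icc s t) :=
    fun {w} hw hwS x hx ↦ by
      rw [truncatedField_eq_singularField (hwS x hx) (hM w hw hwS x hx)]
      exact hw x hx
  exact (htr hy hyS).eqOn_Icc_of_lipschitz he hK (htr hz hzS) h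

theorem isCompact_stripData (hc : 0 ≤ c) (hs : 0 < s) (hst : s < t) {e : ℝ} (he : e ∈ Icc s t) :
    IsCompact (stripData a b c s t e) := by
  obtain ⟨M₀, hM₀⟩ := exists_slope_bound_singularField a b hc hs hst
  set M := max 0 M₀
  have hM0 : 0 ≤ M := le_max_left _ _
  have hM : ∀ y : ℝ → ℝ × ℝ, IsIntegralCurveOn y (singularField a b c) (Icc s t) →
      InStrip y (Icc s t) → ∀ x ∈ Icc s t, |(y x).2| ≤ M := fun y hy hS x hx ↦
    (hM₀ y hy hS x hx).trans (le_max_right _ _)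
  obtain ⟨L, hL⟩ := exists_norm_truncatedField_le a b hc hs hst.le hM0
  obtain ⟨K, hK⟩ := exists_lipschitzWith_truncatedField a b hc hs hst.le hM0
  obtain ⟨Φ, hΦ, hΦc⟩ := exists_flow_of_bounded_of_lipschitz he hK
    (continuousOn_truncatedField hs) hL (max t M)
  -- Membership means that the truncated flow stays in a closed box at each `x`. The ball is
  -- repeated inside the intersection because `Φ` is continuous only there, so that only these
  -- relative preimages are known to be closed.
  have key : stripData a b c s t e = closedBall 0 (max t M) ∩
      ⋂ x ∈ Icc s t, closedBall 0 (max t M) ∩ (Φ · x) ⁻¹' (Icc 0 x ×ˢ Icc (-M) M) := by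
    ext z
    simp only [mem_inter_iff, mem_iInter, mem_preimage]
    constructor
    · rintro ⟨y, hy, hS, rfl⟩
      have hb : y e ∈ closedBall (0 : ℝ × ℝ) (max t M) := by
        rw [mem_closedBall_zero_iff]
        refine max_le_max ?_ (hM y hy hS e he)
        rw [Real.norm_eq_abs, abs_of_nonneg (hS e he).1]
        exact (hS e he).2.trans he.2
      obtain ⟨h0, h1⟩ := hΦ _ hb
      have hy' : IsIntegralCurveOn y (truncatedField a b c M) (Icc s t) := fun x hx ↦ by
        rw [truncatedField_eq_singularField (hS x hx) (hM y hy hS x hx)]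
        exact hy x hx
      refine ⟨hb, fun x hx ↦ ⟨hb, ?_⟩⟩
      rw [h1.eqOn_Icc_of_lipschitz he hK hy' h0 hx]
      exact ⟨hS x hx, abs_le.1 (hM y hy hS x hx)⟩
    · rintro ⟨hb, h⟩
      obtain ⟨h0, h1⟩ := hΦ _ hb
      refine ⟨Φ z, fun x hx ↦ ?_, fun x hx ↦ (h x hx).2.1, h0⟩
      rw [← truncatedField_eq_singularField (M := M) (h x hx).2.1 (abs_le.2 (h x hx).2.2)]
      exact h1 x hx
  rw [key]
  refine (isCompact_closedBall _ _).inter_right (isClosed_biInter fun x hx ↦ ?_)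
  exact (hΦc x hx).preimage_isClosed_of_isClosed isClosed_closedBall (isClosed_Icc.prod isClosed_Icc)

/-- Solutions in the strip on an increasing sequence of compact intervals yield a solution on their
union, together with `0`. -/
theorem exists_solution_of_exhaustion (hc : 0 ≤ c) {s t : ℕ → ℝ} {e : ℝ} {J C : Set ℝ}
    (hs : Antitone s) (ht : Monotone t) (hs0 : ∀ n, 0 < s n) (hst : ∀ n, s n < t n)
    (he : ∀ n, e ∈ Icc (s n) (t n)) (hJ : J ⊆ Ici 0)
    (hnhds : ∀ x ∈ J, 0 < x → ∃ n, Icc (s n) (t n) ∈ 𝓝[J] x) (hC : IsClosed C)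
    (hex : ∀ n, ∃ z ∈ stripData a b c (s n) (t n) e, z.1 ∈ C) :
    ∃ u : ℝ → ℝ, IsSingularIVPSolution a b c J u ∧ (∀ x ∈ J, 0 ≤ u x ∧ u x ≤ x) ∧ u e ∈ C := by
  have hcpt := fun n ↦ isCompact_stripData (a := a) (b := b) hc (hs0 n) (hst n) (he n)
  have hCc : IsClosed (Prod.fst ⁻¹' C : Set (ℝ × ℝ)) := hC.preimage continuous_fst
  -- Cantor intersection: one datum `z` at `e` works for every interval, and uniqueness glues the
  -- curves through it.
  obtain ⟨z, hz⟩ := IsCompact.nonempty_iInter_of_sequence_nonempty_isCompact_isClosed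
    (fun n ↦ stripData a b c (s n) (t n) e ∩ Prod.fst ⁻¹' C)
    (fun n ↦ inter_subset_inter_left _ (stripData_subset
      (Icc_subset_Icc (hs n.le_succ) (ht n.le_succ))))
    (fun n ↦ let ⟨z, h1, h2⟩ := hex n; ⟨z, h1, h2⟩) ((hcpt 0).inter_right hCc)
    (fun n ↦ (hcpt n).isClosed.inter hCc)
  rw [mem_iInter] at hz
  choose y hy hyS hye using fun n ↦ (hz n).1
  have hmono : ∀ {n m}, n ≤ m → EqOn (y n) (y m) (Icc (s n) (t n)) := fun {n m} hnm ↦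
    have hsub := Icc_subset_Icc (hs hnm) (ht hnm)
    strip_solution_unique hc (hs0 n) (hst n) (he n) (hy n) (hyS n) ((hy m).mono hsub)
      (fun x hx ↦ hyS m x (hsub hx)) ((hye n).trans (hye m).symm)
  have hagree : ∀ n m x, x ∈ Icc (s n) (t n) → x ∈ Icc (s m) (t m) → y n x = y m x := by
    intro n m x hn hm
    rcases le_total n m with h | h
    exacts [hmono h hn, (hmono h hm).symm]
  classical
  -- The default value `0` supplies the initial condition, since no interval contains `0`.
  let Y : ℝ → ℝ × ℝ := fun x ↦ if h : ∃ n, x ∈ Icc (s n) (t n) then y h.choose x else 0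
  have hY : ∀ n, EqOn Y (y n) (Icc (s n) (t n)) := fun n x hx ↦ by
    have h : ∃ n, x ∈ Icc (s n) (t n) := ⟨n, hx⟩
    simp only [Y, dif_pos h]
    exact hagree _ _ x h.choose_spec hx
  have hY0 : Y 0 = 0 := dif_neg fun ⟨n, hn⟩ ↦ (hs0 n).not_ge hn.1
  have hbd : ∀ x ∈ J, (Y x).1 ∈ Icc 0 x := by
    intro x hx
    rcases (mem_Ici.1 (hJ hx)).eq_or_lt with rfl | h0
    · simp [hY0]
    · obtain ⟨n, hn⟩ := hnhds x hx h0
      have hxn := mem_of_mem_nhdsWithin hx hn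
      rw [hY n hxn]
      exact hyS n x hxn
  have hderiv : ∀ x ∈ interior J, HasDerivAt Y (singularField a b c x (Y x)) x := by
    intro x hx
    have hx0 : 0 < x := by
      have := interior_mono hJ hx
      rwa [interior_Ici] at this
    obtain ⟨n, hn⟩ := hnhds x (interior_subset hx) hx0
    rw [nhdsWithin_eq_nhds.2 (mem_interior_iff_mem_nhds.1 hx)] at hn
    rw [hY n (mem_of_mem_nhds hn)]
    exact ((hy n x (mem_of_mem_nhds hn)).hasDerivAt hn).congr_of_eventuallyEq
      (eventually_of_mem hn (hY n))
  have hd1 : ∀ x ∈ interior J, HasDerivAt (fun x ↦ (Y x).1) (Y x).2 x := fun x hx ↦ by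
    simpa [singularField] using (hderiv x hx).hasFDerivAt.fst.hasDerivAt
  have hd2 : ∀ x ∈ interior J,
      HasDerivAt (fun x ↦ (Y x).2) (singularRHS a b c x (Y x).1 (Y x).2) x := fun x hx ↦ by
    simpa [singularField] using (hderiv x hx).hasFDerivAt.snd.hasDerivAt
  have hdd : ∀ x ∈ interior J,
      deriv (deriv fun x ↦ (Y x).1) x = singularRHS a b c x (Y x).1 (Y x).2 := fun x hx ↦ by
    have : deriv (fun x ↦ (Y x).1) =ᶠ[𝓝 x] fun x ↦ (Y x).2 :=
      eventually_of_mem (isOpen_interior.mem_nhds hx) fun w hw ↦ (hd1 w hw).deriv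
    rw [this.deriv_eq, (hd2 x hx).deriv]
  have hpos : ∀ x ∈ interior J, x ^ 2 ≠ 0 := fun x hx ↦ by
    have := interior_mono hJ hx
    rw [interior_Ici] at this
    exact (pow_pos this 2).ne'
  refine ⟨fun x ↦ (Y x).1, ⟨?_, ?_, ?_, by rw [hY0]; rfl⟩, hbd, ?_⟩
  · intro x hx
    rcases (mem_Ici.1 (hJ hx)).eq_or_lt with rfl | h0
    · have h : Tendsto (fun x : ℝ ↦ x) (𝓝[J] 0) (𝓝 0) := nhdsWithin_le_nhds
      rw [ContinuousWithinAt, hY0]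
      exact tendsto_of_tendsto_of_tendsto_of_le_of_le' tendsto_const_nhds h
        (eventually_of_mem self_mem_nhdsWithin fun w hw ↦ (hbd w hw).1)
        (eventually_of_mem self_mem_nhdsWithin fun w hw ↦ (hbd w hw).2)
    · obtain ⟨n, hn⟩ := hnhds x hx h0
      have hxn := mem_of_mem_nhdsWithin hx hn
      have h := ((hy n).fst hxn).continuousWithinAt.mono_of_mem_nhdsWithin hn
      refine h.congr_of_eventuallyEq (eventually_of_mem hn fun w hw ↦ ?_) ?_
      · simp only [hY n hw]
      · simp only [hY n hxn]
  · rw [show (2 : WithTop ℕ∞) = 1 + 1 by norm_num, contDiffOn_succ_iff_deriv_of_isOpen isOpen_interior]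
    refine ⟨fun x hx ↦ (hd1 x hx).differentiableAt.differentiableWithinAt, by simp, ?_⟩
    have h2 : ContDiffOn ℝ 1 (fun x ↦ (Y x).2) (interior J) := by
      rw [show (1 : WithTop ℕ∞) = 0 + 1 by norm_num,
        contDiffOn_succ_iff_deriv_of_isOpen isOpen_interior]
      refine ⟨fun x hx ↦ (hd2 x hx).differentiableAt.differentiableWithinAt, by simp, ?_⟩
      rw [contDiffOn_zero]
      have hc1 : ContinuousOn (fun x ↦ (Y x).1) (interior J) := fun x hx ↦
        (hd1 x hx).continuousAt.continuousWithinAt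
      have hc2 : ContinuousOn (fun x ↦ (Y x).2) (interior J) := fun x hx ↦
        (hd2 x hx).continuousAt.continuousWithinAt
      refine ContinuousOn.congr (f := fun x ↦ singularRHS a b c x (Y x).1 (Y x).2) ?_
        fun x hx ↦ (hd2 x hx).deriv
      unfold singularRHS
      exact ContinuousOn.div (by fun_prop) (by fun_prop) hpos
    exact h2.congr fun x hx ↦ (hd1 x hx).deriv
  · intro x hx
    rw [hdd x hx, (hd1 x hx).deriv, singularRHS, mul_div_cancel₀ _ (hpos x hx)]
  · have : (Y e).1 = z.1 := by rw [hY 0 (he 0), hye 0]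
    simp only [this]
    exact (hz 0).2

end BoundaryValue

/-! ### Global solutions and the cardinality count. -/

theorem exists_solution_Icc {a b c x₀ ξ : ℝ} (hab : 0 ≤ a + b) (hc : 0 ≤ c) (hx₀ : 0 < x₀)
    (hξ : ξ ∈ Icc 0 x₀) : ∃ u : ℝ → ℝ, IsSingularIVPSolution a b c (Icc 0 x₀) u ∧
      (∀ x ∈ Icc 0 x₀, 0 ≤ u x ∧ u x ≤ x) ∧ u x₀ = ξ := by
  have hs0 : ∀ n : ℕ, 0 < x₀ / (n + 2) := fun n ↦ by positivity
  have hst : ∀ n : ℕ, x₀ / (n + 2) < x₀ := fun n ↦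
    div_lt_self hx₀ (by have : (0 : ℝ) ≤ n := n.cast_nonneg; linarith)
  -- Taking the right end point as `e` lets the closed condition `C = {ξ}` preserve the terminal
  -- value in the limit.
  refine exists_solution_of_exhaustion (C := {ξ}) (s := fun n ↦ x₀ / (n + 2)) (t := fun _ ↦ x₀)
    hc ?_ monotone_const hs0 hst (fun n ↦ ⟨(hst n).le, le_rfl⟩) (fun x hx ↦ hx.1) ?_ isClosed_singleton ?_
  · intro n m hnm
    have : (n : ℝ) ≤ m := by exact_mod_cast hnm
    simp only
    gcongr
  · intro x hx h0
    obtain ⟨n, hn⟩ := exists_nat_gt (x₀ / x)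
    have hlt : x₀ / (n + 2) < x := by
      rw [div_lt_iff₀ h0] at hn
      rw [div_lt_iff₀ (by positivity)]
      nlinarith
    refine ⟨n, mem_nhdsWithin.2 ⟨Ioi (x₀ / (n + 2)), isOpen_Ioi, hlt, fun w hw ↦ ⟨?_, hw.2.2⟩⟩⟩
    exact (show x₀ / (n + 2) < w from hw.1).le
  · intro n
    obtain ⟨y, hy, hS, h⟩ := exists_strip_solution_Icc hab hc (hs0 n) (hst n) hξ
    exact ⟨y x₀, ⟨y, hy, hS, rfl⟩, h⟩

theorem exists_solution_Ici {a b c : ℝ} (hab : 0 ≤ a + b) (hc : 0 ≤ c) :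
    ∃ u : ℝ → ℝ, IsSingularIVPSolution a b c (Ici 0) u ∧ ∀ x ∈ Ici (0 : ℝ), 0 ≤ u x ∧ u x ≤ x := by
  have hn2 : ∀ n : ℕ, (1 : ℝ) < n + 2 := fun n ↦ by
    have : (0 : ℝ) ≤ n := n.cast_nonneg
    linarith
  have hs0 : ∀ n : ℕ, (0 : ℝ) < 1 / (n + 2) := fun n ↦ by positivity
  have hs1 : ∀ n : ℕ, (1 : ℝ) / (n + 2) < 1 := fun n ↦ div_lt_self one_pos (hn2 n)
  suffices h : ∃ u : ℝ → ℝ, IsSingularIVPSolution a b c (Ici 0) u ∧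
      (∀ x ∈ Ici (0 : ℝ), 0 ≤ u x ∧ u x ≤ x) ∧ u 1 ∈ univ from
    let ⟨u, hu, hb, _⟩ := h; ⟨u, hu, hb⟩
  refine exists_solution_of_exhaustion (a := a) (b := b) (C := univ) (J := Ici 0)
    (s := fun n : ℕ ↦ 1 / ((n : ℝ) + 2)) (t := fun n : ℕ ↦ (n : ℝ) + 2) (e := 1) hc ?_ ?_ hs0
    (fun n ↦ (hs1 n).trans (hn2 n)) (fun n ↦ ⟨(hs1 n).le, (hn2 n).le⟩)
    subset_rfl ?_ isClosed_univ ?_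
  · intro n m hnm
    have : (n : ℝ) ≤ m := by exact_mod_cast hnm
    simp only
    gcongr
  · intro n m hnm
    simpa using hnm
  · intro x _ h0
    obtain ⟨n, hn⟩ := exists_nat_gt (max (1 / x) x)
    rw [max_lt_iff, div_lt_iff₀ h0] at hn
    refine ⟨n, mem_nhdsWithin_of_mem_nhds (Icc_mem_nhds ?_ (by linarith))⟩
    rw [div_lt_iff₀ (by positivity)]
    nlinarith
  · intro n
    obtain ⟨y, hy, hS, -⟩ := exists_strip_solution_Icc (a := a) (b := b) hab hc (hs0 n)
      ((hs1 n).trans (hn2 n)) (ξ := 0) ⟨le_rfl, by linarith [hn2 n]⟩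
    exact ⟨y 1, ⟨y, hy, hS, rfl⟩, trivial⟩

/-- A separable space carries at most continuum many continuous real functions. -/
theorem Cardinal.mk_setOf_continuous_le {X : Type} [TopologicalSpace X]
    [TopologicalSpace.SeparableSpace X] : Cardinal.mk {f : X → ℝ | Continuous f} ≤ Cardinal.continuum := by
  obtain ⟨D, hDc, hD⟩ := TopologicalSpace.exists_countable_dense X
  have : Countable D := hDc
  have hinj : Function.Injective fun (f : {f : X → ℝ | Continuous f}) (x : D) ↦ f.1 x := by
    intro f g hfg
    refine Subtype.ext (Continuous.ext_on hD f.2 g.2 fun x hx ↦ congrFun hfg ⟨x, hx⟩)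
  refine (Cardinal.mk_le_of_injective hinj).trans ?_
  rw [Cardinal.mk_arrow, Cardinal.lift_id, Cardinal.lift_id, Cardinal.mk_real]
  calc _ ≤ Cardinal.continuum ^ Cardinal.aleph0 :=
        Cardinal.power_le_power_left Cardinal.continuum_ne_zero (Cardinal.mk_le_aleph0)
    _ = _ := Cardinal.continuum_power_aleph0

theorem proposition1p3 (a b c : ℝ) (hc : 0 < c) :
    (0 < a + b → ∀ x₀ : ℝ, 0 < x₀ →
      Cardinal.mk (boundedSolutions a b c x₀) = Cardinal.continuum) ∧
    (0 ≤ a + b → ∃ u : ℝ → ℝ, IsSingularIVPSolution a b c (Set.Ici 0) u ∧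
      ∀ x ∈ Set.Ici (0 : ℝ), 0 ≤ u x ∧ u x ≤ x) := by
  refine ⟨fun hab x₀ hx₀ ↦ le_antisymm ?_ ?_, fun hab ↦ exists_solution_Ici hab hc.le⟩
  · refine (Cardinal.mk_le_mk_of_subset ?_).trans
      (Cardinal.mk_setOf_continuous_le (X := Icc (0 : ℝ) x₀))
    rintro v ⟨u, hu, -, rfl⟩
    exact continuousOn_iff_continuous_domRestrict.1 hu.continuousOn
  · rw [← Cardinal.mk_Icc_real hx₀]
    choose! u hu hb hval using fun ξ (hξ : ξ ∈ Icc 0 x₀) ↦ exists_solution_Icc hab.le hc.le hx₀ hξ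
    -- Injectivity holds because the solution built from `ξ` takes the value `ξ` at `x₀`.
    refine Cardinal.mk_le_of_injective (f := fun ξ : Icc (0 : ℝ) x₀ ↦
      (⟨(Icc (0 : ℝ) x₀).domRestrict (u ξ), u ξ, hu ξ ξ.2, hb ξ ξ.2, rfl⟩ :
        boundedSolutions a b c x₀)) fun ξ η h ↦ Subtype.ext ?_
    have := congrFun (congrArg Subtype.val h) ⟨x₀, hx₀.le, le_rfl⟩
    simpa [hval ξ ξ.2, hval η η.2] using this
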